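/- Let $\mathcal A$ be a unital Banach algebra over the quaternions $\mathbf H$: a complete unital normed ring with $\|1\|=1$ and $\|xy\|\le\|x\|\,\|y\|$ that is an $\mathbf H$-bimodule, such that real scalars act in the same way on both sides, $q(xy)=(qx)y$, $(xy)q=x(yq)$, $(xq)y=x(qy)$ and $\|qx\|=|q|\,\|x\|=\|xq\|$ for $x,y\in\mathcal A$, $q\in\mathbf H$. Let $\mathcal A$ be a $C^*$-algebra over $\mathbf H$: it carries an additive involution with $x^{**}=x$, $(xy)^*=y^*x^*$, $(qx)^*=x^*\tilde q$ (where $\tilde q$ is the conjugate quaternion) and $\|x^*x\|=\|x\|^2$. Let $\mathcal A$ be quasi-commutative: there is a commutative algebra $\mathcal A_{0,0}$ over $\mathbf R$ such that $\mathcal A$ is isomorphic, as a real algebra, to $$\left\{\begin{pmatrix}A&B\\-\bar B&\bar A\end{pmatrix}: A,B\in\mathcal A_0\right\},\qquad \mathcal A_0=\{A_0+A_1\mathbf i: A_0,A_1\in\mathcal A_{0,0}\},\quad \mathbf i^2=-1,\quad \overline{A_0+A_1\mathbf i}=A_0-A_1\mathbf i,$$ and such that the elements of $\mathcal A$ which correspond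 to elements of $\mathcal A_{0,0}$ (the matrices with $A\in\mathcal A_{0,0}$, $B=0$) are self-adjoint. Let $\Lambda$ be the spectrum of $\mathcal A$, that is, the set of all maximal proper two-sided ideals of $\mathcal A$. Then for each $x\in\mathcal A$ and $M\in\Lambda$ there is exactly one quaternion $x(M)$ with $x-x(M)\cdot 1\in M$. In the coarsest topology for which all the functions $M\mapsto x(M)$, $x\in\mathcal A$, are continuous, $\Lambda$ is a compact Hausdorff space. The map $x\mapsto x(\cdot)$ is an $\mathbf H$-linear (on both sides) isometric $*$-isomorphism of $\mathcal A$ onto the algebra $C(\Lambda,\mathbf H)$ of all continuous $\mathbf H$-valued functions on $\Lambda$ with the supremum norm and the pointwise quaternionic conjugation as involution. -/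

import Mathlib

open scoped Quaternion
open MulOpposite

universe u

namespace QuaternionCStar

/-- A Banach algebra over `ℍ` with unit: a complete unital normed ring which is an `ℍ`-bimodule
(`q • x` is the product of a vector with a scalar on the left, `op q • x` on the right), where real
scalars act in the same way on both sides, scalars associate with the multiplication of `A`,
`‖1‖ = 1`, and the norm is multiplicative on left and on right scalars.
The inequality `‖x * y‖ ≤ ‖x‖ * ‖y‖` is part of `NormedRing A`. -/
structure IsBanachAlgebra (A : Type u) [NormedRing A] [NormedAlgebra ℝ A]
    [Module ℍ[ℝ] A] [Module (ℍ[ℝ])ᵐᵒᵖ A] : Prop where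
  complete : CompleteSpace A
  norm_one : ‖(1 : A)‖ = 1
  norm_left_smul : ∀ (q : ℍ[ℝ]) (x : A), ‖q • x‖ = ‖q‖ * ‖x‖
  norm_right_smul : ∀ (q : ℍ[ℝ]) (x : A), ‖op q • x‖ = ‖q‖ * ‖x‖
  left_right_comm : ∀ (p q : ℍ[ℝ]) (x : A), op q • p • x = p • op q • x
  real_left_smul : ∀ (r : ℝ) (x : A), (r : ℍ[ℝ]) • x = r • x
  real_right_smul : ∀ (r : ℝ) (x : A), op (r : ℍ[ℝ]) • x = r • x
  left_assoc : ∀ (q : ℍ[ℝ]) (x y : A), q • (x * y) = (q • x) * y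
  right_assoc : ∀ (q : ℍ[ℝ]) (x y : A), op q • (x * y) = x * (op q • y)
  middle_assoc : ∀ (q : ℍ[ℝ]) (x y : A), (op q • x) * y = x * (q • y)

/-- A `C*`-algebra over `ℍ`: a Banach algebra over `ℍ` with an involution `star` that is involutive,
additive and antimultiplicative (`StarRing A`), satisfies `(q x)* = x* q̃`, where `q̃` is the
conjugate quaternion, and obeys the `C*`-identity. -/
structure IsCStarAlgebra (A : Type u) [NormedRing A] [NormedAlgebra ℝ A] [StarRing A]
    [Module ℍ[ℝ] A] [Module (ℍ[ℝ])ᵐᵒᵖ A] : Prop extends IsBanachAlgebra A where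
  star_left_smul : ∀ (q : ℍ[ℝ]) (x : A), star (q • x) = op (star q) • star x
  cstar_identity : ∀ x : A, ‖star x * x‖ = ‖x‖ ^ 2

/-- The complexification `{a₀ + a₁ 𝐢 : a₀, a₁ ∈ R}`, `𝐢² = -1`, of a commutative real algebra `R`.
Its `star` is the conjugation `a₀ + a₁ 𝐢 ↦ a₀ - a₁ 𝐢`. -/
abbrev Complexification (R : Type u) [CommRing R] : Type u := QuadraticAlgebra R (-1) 0

/-- The real algebra of all matrices `!![a, b; -b̄, ā]` with `a, b` in the complexification
of the commutative real algebra `R`. -/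
def quatMatrix (R : Type u) [CommRing R] [Algebra ℝ R] :
    Subalgebra ℝ (Matrix (Fin 2) (Fin 2) (Complexification R)) where
  carrier := {T | ∃ a b : Complexification R, T = !![a, b; -star b, star a]}
  mul_mem' := by
    rintro _ _ ⟨a, b, rfl⟩ ⟨c, d, rfl⟩
    refine ⟨a * c - b * star d, a * d + b * star c, ?_⟩
    refine Matrix.ext fun i j => ?_
    fin_cases i <;> fin_cases j <;> simp <;> ring
  add_mem' := by
    rintro _ _ ⟨a, b, rfl⟩ ⟨c, d, rfl⟩
    refine ⟨a + c, b + d, ?_⟩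
    refine Matrix.ext fun i j => ?_
    fin_cases i <;> fin_cases j <;> simp <;> ring
  algebraMap_mem' r := by
    have him : (algebraMap ℝ (Complexification R) r).im = 0 := rfl
    refine ⟨algebraMap ℝ _ r, 0, ?_⟩
    refine Matrix.ext fun i j => ?_
    fin_cases i <;> fin_cases j <;> simp [Matrix.algebraMap_matrix_apply] <;>
      ext <;> simp [him]

/-- An element `a` of `R`, as the diagonal matrix with both diagonal entries `a`. -/
def quatMatrixOf (R : Type u) [CommRing R] [Algebra ℝ R] (a : R) : quatMatrix R :=
  ⟨!![⟨a, 0⟩, 0; 0, ⟨a, 0⟩], ⟨⟨a, 0⟩, 0, by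
    refine Matrix.ext fun i j => ?_
    fin_cases i <;> fin_cases j <;> simp⟩⟩

/-- Quasi-commutativity of a real algebra `A` with an involution: `A` is isomorphic to the
algebra of matrices `!![a, b; -b̄, ā]` over the complexification of a commutative real
algebra `R`, and the elements of `A` that correspond to elements of `R` are self-adjoint.
The isomorphism is only asked to be one of real algebras, which is less than `ℍ`-linearity. -/
def IsQuasiCommutative (A : Type u) [Ring A] [Algebra ℝ A] [Star A] : Prop :=
  ∃ (R : Type u) (_ : CommRing R) (_ : Algebra ℝ R) (φ : quatMatrix R ≃ₐ[ℝ] A),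
    ∀ a : R, IsSelfAdjoint (φ (quatMatrixOf R a))

/-- The spectrum (structure space) of `A`, as a set: all maximal proper two-sided ideals. -/
def Spectrum (A : Type u) [Ring A] : Type u := {M : TwoSidedIdeal A // IsCoatom M}

/-- The value `x(M)`: the quaternion `q` with `x + M = q + M`. -/
noncomputable def value {A : Type u} [Ring A] [Module ℍ[ℝ] A] (x : A) (M : Spectrum A) : ℍ[ℝ] :=
  Classical.epsilon fun q : ℍ[ℝ] => x - q • (1 : A) ∈ M.1

/-- The topology of the spectrum: the coarsest one for which all the functions `M ↦ x(M)` are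
continuous. -/
noncomputable instance (A : Type u) [Ring A] [Module ℍ[ℝ] A] : TopologicalSpace (Spectrum A) :=
  TopologicalSpace.induced (fun (M : Spectrum A) (x : A) => value x M) inferInstance

end QuaternionCStar

/-!
Write `i`, `j` for the images `q • 1` of the quaternion units in `A`; both scalar actions are
multiplications by such images. Every `x` decomposes as `x₀ + i x₁ + j x₂ + k x₃` with components
commuting with `i` and `j` (`IsUnitPair.eq_sum_unitAvg`), the real component `x₀` being the average
of the conjugates of `x` by `1, i, j, k`.

The isomorphism with a matrix algebra need not respect the quaternion scalars, and is used only
through the reduced trace: every `x` satisfies `x² - τ(x) x + n(x) = 0` with central coefficients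
and self-adjoint `τ(x)` (`IsQuasiCommutative.exists_trace`). Polarizing this at `i` and an element
`c` that commutes with `i` and `j` gives `2 c = τ(c)` (`IsUnitPair.add_self_eq_trace`). So the
components of every element lie in the centre, and the centre consists of self-adjoint elements.

The centralizer of `i` is therefore commutative, and it is a complex `C*`-algebra
(`IsCStarAlgebra.exists_commCStarAlgebra`). The Gelfand representation identifies its self-adjoint
part, which is the centre of `A`, with `C(X, ℝ)` for a compact space `X`
(`IsCStarAlgebra.exists_center_equiv`). A proper two-sided ideal contains the components of its
elements, so it lies in the ideal of a point of `X`; these point ideals have quotient `ℍ`. Hence they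
are all the maximal ideals (`IsCStarAlgebra.exists_spectrum_param`), and the spectrum is a
continuous image of `X`. The components give bijectivity of `x ↦ x(·)`. It is isometric on the
centre, and `x* x` is central, so the `C*`-identity makes it isometric on `A`.
-/

namespace QuaternionCStar

/-! ### The reduced trace of a quasi-commutative algebra -/

/-- A quasi-commutative algebra carries a reduced trace `τ` with self-adjoint central values for
which every `x` satisfies the quadratic equation `x² - τ(x) x + n(x) = 0` with `n(x)` central.
For the matrices `!![a, b; -b̄, ā]` this is the Cayley-Hamilton theorem, with `τ = a + ā` and
`n = a ā + b b̄`. -/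
theorem IsQuasiCommutative.exists_trace {A : Type u} [Ring A] [Algebra ℝ A] [Star A]
    (h : IsQuasiCommutative A) :
    ∃ τ : A → A, (∀ x y, τ (x + y) = τ x + τ y) ∧ (∀ x, IsSelfAdjoint (τ x)) ∧
      (∀ x, τ x ∈ Subring.center A) ∧ ∀ x, x * x - τ x * x ∈ Subring.center A := by
  obtain ⟨R, _, _, φ, hφ⟩ := h
  have hcomm : ∀ (r : R) (T : quatMatrix R), T * quatMatrixOf R r = quatMatrixOf R r * T := by
    rintro r ⟨_, a, b, rfl⟩
    refine Subtype.ext (Matrix.ext fun i j => ?_)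
    fin_cases i <;> fin_cases j <;> simp [quatMatrixOf, mul_comm]
  have hcen : ∀ r : R, φ (quatMatrixOf R r) ∈ Subring.center A := by
    intro r
    refine Subring.mem_center_iff.2 fun y => ?_
    rw [← φ.apply_symm_apply y, ← map_mul, ← map_mul, hcomm]
  have hadd : ∀ r s : R, quatMatrixOf R (r + s) = quatMatrixOf R r + quatMatrixOf R s := by
    intro r s
    refine Subtype.ext (Matrix.ext fun i j => ?_)
    fin_cases i <;> fin_cases j <;> simp [quatMatrixOf, QuadraticAlgebra.ext_iff]
  refine ⟨fun x => φ (quatMatrixOf R (2 * ((φ.symm x).1 0 0).re)), fun x y => ?_, fun x => hφ _,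
    fun x => hcen _, fun x => ?_⟩
  · rw [← map_add, ← hadd]
    simp [mul_add]
  · obtain ⟨T, rfl⟩ := φ.surjective x
    obtain ⟨_, a, b, rfl⟩ := T
    beta_reduce
    rw [show φ.symm (φ _) = _ from φ.symm_apply_apply _]
    refine (congrArg (· ∈ Subring.center A) ?_).mpr
      (hcen (-(a.re * a.re + a.im * a.im + b.re * b.re + b.im * b.im)))
    rw [← map_mul, ← map_mul, ← map_sub]
    refine congrArg φ (Subtype.ext (Matrix.ext fun i j => ?_))
    fin_cases i <;> fin_cases j <;> simp [quatMatrixOf, QuadraticAlgebra.ext_iff] <;>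
      (try constructor) <;> ring

/-! ### Quaternion units and the components of an element -/

/-- Two anticommuting square roots of `-1`, that is, a copy of the quaternion units `i` and `j`. -/
structure IsUnitPair {A : Type u} [Ring A] (I J : A) : Prop where
  II : I * I = -1
  JJ : J * J = -1
  JI : J * I = -(I * J)

namespace IsUnitPair

variable {A : Type u} [Ring A] {I J : A}

theorem II_mul (h : IsUnitPair I J) (x : A) : I * (I * x) = -x := by
  rw [← mul_assoc, h.II, neg_one_mul]

theorem JJ_mul (h : IsUnitPair I J) (x : A) : J * (J * x) = -x := by
  rw [← mul_assoc, h.JJ, neg_one_mul]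

theorem JI_mul (h : IsUnitPair I J) (x : A) : J * (I * x) = -(I * (J * x)) := by
  rw [← mul_assoc, h.JI, neg_mul, mul_assoc]

/-- If `d` commutes with `j` and `i d` is central, then `i d` both commutes and anticommutes with
`j`, so `d = 0`. -/
theorem eq_zero_of_mul_mem_center [Algebra ℝ A] (h : IsUnitPair I J) {d : A}
    (hJ : J * d = d * J) (hz : I * d ∈ Subring.center A) : d = 0 := by
  have h1 : J * (I * d) = I * d * J := Subring.mem_center_iff.1 hz J
  rw [h.JI_mul, mul_assoc, ← hJ] at h1
  have h2 : I * (J * d) = 0 := by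
    have h3 : (2 : ℝ) • (I * (J * d)) = 0 := by
      rw [two_smul]
      nth_rewrite 1 [← h1]
      exact neg_add_cancel _
    exact (smul_eq_zero.1 h3).resolve_left two_ne_zero
  have h4 : J * (I * (I * (J * d))) = 0 := by rw [h2, mul_zero, mul_zero]
  rwa [h.II_mul, mul_neg, h.JJ_mul, neg_neg] at h4

/-- An element commuting with the quaternion units is half its reduced trace. The units have
trace zero, and polarizing the quadratic equation at `i` and `c` shows that `i (2 c - τ(c))` is
central. -/
theorem add_self_eq_trace [Algebra ℝ A] (h : IsUnitPair I J) {τ : A → A}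
    (hadd : ∀ x y, τ (x + y) = τ x + τ y) (hcen : ∀ x, τ x ∈ Subring.center A)
    (hquad : ∀ x, x * x - τ x * x ∈ Subring.center A) {c : A}
    (hI : I * c = c * I) (hJ : J * c = c * J) : c + c = τ c := by
  have hτI : τ I = 0 := by
    refine h.eq_zero_of_mul_mem_center (Subring.mem_center_iff.1 (hcen I) J) ?_
    have h1 := hquad I
    rw [h.II, ← Subring.mem_center_iff.1 (hcen I) I] at h1
    have h2 := sub_mem (neg_mem (one_mem (Subring.center A))) h1
    rwa [sub_sub_cancel] at h2
  have hpol : I * (c + c - τ c) ∈ Subring.center A := by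
    have h1 := sub_mem (sub_mem (hquad (I + c)) (hquad I)) (hquad c)
    refine (congrArg (· ∈ Subring.center A) ?_).mpr h1
    rw [hadd, hτI, mul_sub, Subring.mem_center_iff.1 (hcen c) I, mul_add]
    nth_rewrite 2 [hI]
    noncomm_ring
  refine sub_eq_zero.1 (h.eq_zero_of_mul_mem_center (J := J) (I := I) ?_ hpol)
  rw [mul_sub, sub_mul, mul_add, add_mul, hJ, Subring.mem_center_iff.1 (hcen c) J]

end IsUnitPair

section Avg

variable {A : Type u} [Ring A] [Algebra ℝ A] {I J : A}

/-- The average of the conjugates of `x` by the units `1, i, j, k`. It is the real component of `x`: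
the projection onto the centralizer of `i` and `j` along the other three components. -/
noncomputable def unitAvg (I J x : A) : A :=
  (1 / 4 : ℝ) • (x - I * x * I - J * x * J - I * J * x * (I * J))

theorem unitAvg_add (x y : A) : unitAvg I J (x + y) = unitAvg I J x + unitAvg I J y := by
  simp only [unitAvg, ← smul_add, mul_add, add_mul]
  congr 1
  abel

theorem unitAvg_zero : unitAvg I J (0 : A) = 0 := by simp [unitAvg]

theorem unitAvg_neg (x : A) : unitAvg I J (-x) = -unitAvg I J x := by
  rw [eq_neg_iff_add_eq_zero, ← unitAvg_add, neg_add_cancel, unitAvg_zero]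

theorem unitAvg_center_mul {z : A} (hz : z ∈ Subring.center A) (x : A) :
    unitAvg I J (z * x) = z * unitAvg I J x := by
  have h : ∀ y : A, y * z = z * y := fun y => Subring.mem_center_iff.1 hz y
  have h' : ∀ y w : A, y * (z * w) = z * (y * w) := fun y w => by
    rw [← mul_assoc, h, mul_assoc]
  simp only [unitAvg, mul_smul_comm, mul_sub, mul_assoc, h']

theorem unitAvg_mem {M : TwoSidedIdeal A} {x : A} (hx : x ∈ M) : unitAvg I J x ∈ M := by
  rw [unitAvg, Algebra.smul_def]
  refine M.mul_mem_left _ _ (M.sub_mem (M.sub_mem (M.sub_mem hx ?_) ?_) ?_) <;>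
    exact M.mul_mem_right _ _ (M.mul_mem_left _ _ hx)

namespace IsUnitPair

theorem unitAvg_one (h : IsUnitPair I J) : unitAvg I J 1 = 1 := by
  simp only [unitAvg, mul_one, mul_assoc, h.II, h.JJ, h.JI_mul, mul_neg]
  rw [show (1 : A) - -1 - -1 - - - -1 = (4 : ℝ) • 1 by
    rw [Algebra.smul_def, map_ofNat]; norm_num, smul_smul]
  norm_num

theorem comm_unitAvg_left (h : IsUnitPair I J) (x : A) :
    I * unitAvg I J x = unitAvg I J x * I := by
  simp only [unitAvg, mul_smul_comm, smul_mul_assoc, mul_sub, sub_mul, mul_assoc, h.II,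
    h.II_mul, h.JI, mul_neg, mul_one]
  congr 1
  abel

theorem comm_unitAvg_right (h : IsUnitPair I J) (x : A) :
    J * unitAvg I J x = unitAvg I J x * J := by
  simp only [unitAvg, mul_smul_comm, smul_mul_assoc, mul_sub, sub_mul, mul_assoc, h.JJ,
    h.JI_mul, h.JJ_mul, mul_neg, mul_one]
  congr 1
  abel

theorem eq_sum_unitAvg (h : IsUnitPair I J) (x : A) :
    x = unitAvg I J x - I * unitAvg I J (I * x) - J * unitAvg I J (J * x)
      - I * J * unitAvg I J (I * J * x) := by
  simp only [unitAvg, mul_smul_comm, ← smul_sub, mul_sub, mul_assoc,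
    h.JI_mul, h.II_mul, h.JJ_mul, mul_neg, neg_mul]
  rw [eq_comm, one_div, inv_smul_eq_iff₀ (by norm_num), show (4 : ℝ) = 1 + 1 + 1 + 1 by norm_num]
  simp only [add_smul, one_smul]
  abel

/-- An element commuting with `i` has no `j` or `k` component. -/
theorem eq_add_of_comm (h : IsUnitPair I J) {x : A} (hx : I * x = x * I) :
    x = unitAvg I J x - I * unitAvg I J (I * x) := by
  have hx' : ∀ y, I * (x * y) = x * (I * y) := fun y => by rw [← mul_assoc, hx, mul_assoc]
  have hJ : unitAvg I J (J * x) = 0 := by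
    simp only [unitAvg, mul_assoc, ← hx, h.II_mul, h.JJ_mul, h.JI_mul, mul_neg, neg_mul, ← hx']
    refine smul_eq_zero_of_right _ ?_
    abel
  have hK : unitAvg I J (I * J * x) = 0 := by
    simp only [unitAvg, mul_assoc, ← hx, h.II_mul, h.JJ_mul, h.JI_mul, mul_neg, neg_mul, ← hx']
    refine smul_eq_zero_of_right _ ?_
    abel
  have h1 := h.eq_sum_unitAvg x
  rwa [hJ, hK, mul_zero, mul_zero, sub_zero, sub_zero] at h1

end IsUnitPair

end Avg

/-! ### Quaternion scalars inside the algebra -/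

/-- The quaternion unit `i`. -/
def quatI : ℍ[ℝ] := ⟨0, 1, 0, 0⟩

/-- The quaternion unit `j`. -/
def quatJ : ℍ[ℝ] := ⟨0, 0, 1, 0⟩

@[simp] theorem re_quatI : quatI.re = 0 := rfl
@[simp] theorem imI_quatI : quatI.imI = 1 := rfl
@[simp] theorem imJ_quatI : quatI.imJ = 0 := rfl
@[simp] theorem imK_quatI : quatI.imK = 0 := rfl
@[simp] theorem re_quatJ : quatJ.re = 0 := rfl
@[simp] theorem imI_quatJ : quatJ.imI = 0 := rfl
@[simp] theorem imJ_quatJ : quatJ.imJ = 1 := rfl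
@[simp] theorem imK_quatJ : quatJ.imK = 0 := rfl

theorem star_quatI : star quatI = -quatI := by ext <;> simp

theorem norm_coeComplex (c : ℂ) : ‖(c : ℍ[ℝ])‖ = ‖c‖ := by
  rw [← sq_eq_sq₀ (norm_nonneg _) (norm_nonneg _), pow_two, ← Quaternion.normSq_eq_norm_mul_self,
    Quaternion.normSq_def', ← Complex.normSq_eq_norm_sq, Complex.normSq_apply]
  simp [pow_two]

section Scalar

variable {A : Type u} [NormedRing A] [NormedAlgebra ℝ A] [Module ℍ[ℝ] A] [Module (ℍ[ℝ])ᵐᵒᵖ A]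

theorem IsBanachAlgebra.smul_one_mul (hA : IsBanachAlgebra A) (q : ℍ[ℝ]) (x : A) :
    q • (1 : A) * x = q • x := by
  rw [← hA.left_assoc, one_mul]

theorem IsBanachAlgebra.mul_smul_one (hA : IsBanachAlgebra A) (q : ℍ[ℝ]) (x : A) :
    x * q • (1 : A) = op q • x := by
  rw [← hA.middle_assoc, mul_one]

/-- The quaternion scalars as a subalgebra: `q ↦ q • 1`. The two scalar actions are left and right
multiplication by `q • 1`. -/
noncomputable def IsBanachAlgebra.scalarHom (hA : IsBanachAlgebra A) : ℍ[ℝ] →ₐ[ℝ] A where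
  toFun q := q • (1 : A)
  map_one' := one_smul _ _
  map_mul' p q := by rw [hA.smul_one_mul, mul_smul]
  map_zero' := zero_smul _ _
  map_add' p q := add_smul _ _ _
  commutes' r := by
    rw [Algebra.algebraMap_eq_smul_one r (A := A), ← hA.real_left_smul]
    rfl

theorem IsBanachAlgebra.scalarHom_apply (hA : IsBanachAlgebra A) (q : ℍ[ℝ]) :
    hA.scalarHom q = q • (1 : A) := rfl

theorem IsBanachAlgebra.norm_scalarHom_mul (hA : IsBanachAlgebra A) (q : ℍ[ℝ]) (x : A) :
    ‖hA.scalarHom q * x‖ = ‖q‖ * ‖x‖ := by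
  rw [hA.scalarHom_apply, hA.smul_one_mul, hA.norm_left_smul]

theorem IsCStarAlgebra.star_scalarHom [StarRing A] (hA : IsCStarAlgebra A) (q : ℍ[ℝ]) :
    star (hA.scalarHom q) = hA.scalarHom (star q) := by
  rw [hA.scalarHom_apply, hA.star_left_smul, star_one, ← hA.mul_smul_one, one_mul]
  rfl

theorem IsBanachAlgebra.isUnitPair (hA : IsBanachAlgebra A) :
    IsUnitPair (hA.scalarHom quatI) (hA.scalarHom quatJ) := by
  constructor
  · rw [← map_mul, ← map_one hA.scalarHom, ← map_neg]
    congr 1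
    ext <;> simp
  · rw [← map_mul, ← map_one hA.scalarHom, ← map_neg]
    congr 1
    ext <;> simp
  · rw [← map_mul, ← map_mul, ← map_neg]
    congr 1
    ext <;> simp

theorem IsBanachAlgebra.scalarHom_eq (hA : IsBanachAlgebra A) (q : ℍ[ℝ]) :
    hA.scalarHom q = algebraMap ℝ A q.re + hA.scalarHom quatI * algebraMap ℝ A q.imI
      + hA.scalarHom quatJ * algebraMap ℝ A q.imJ
      + hA.scalarHom quatI * hA.scalarHom quatJ * algebraMap ℝ A q.imK := by
  rw [← AlgHom.commutes hA.scalarHom, ← AlgHom.commutes hA.scalarHom,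
    ← AlgHom.commutes hA.scalarHom, ← AlgHom.commutes hA.scalarHom]
  simp only [← map_mul, ← map_add]
  refine congrArg hA.scalarHom ?_
  ext <;> simp [Quaternion.algebraMap_def]

theorem IsBanachAlgebra.scalarHom_coeComplex_comm (hA : IsBanachAlgebra A) (c : ℂ) {x : A}
    (hx : hA.scalarHom quatI * x = x * hA.scalarHom quatI) :
    hA.scalarHom (c : ℍ[ℝ]) * x = x * hA.scalarHom (c : ℍ[ℝ]) := by
  rw [hA.scalarHom_eq]
  simp only [Quaternion.re_coeComplex, Quaternion.imI_coeComplex, Quaternion.imJ_coeComplex,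
    Quaternion.imK_coeComplex, map_zero, mul_zero, add_zero, add_mul, mul_add]
  rw [Algebra.commutes, mul_assoc, Algebra.commutes, ← mul_assoc, hx, mul_assoc]

end Scalar

/-! ### The centralizer of `i` and the Gelfand representation of the centre -/

section Center

variable {A : Type u} [NormedRing A] [NormedAlgebra ℝ A] [StarRing A]
  [Module ℍ[ℝ] A] [Module (ℍ[ℝ])ᵐᵒᵖ A]

/-- The elements commuting with the quaternion units are central and self-adjoint: they are half
their reduced trace. -/
theorem IsCStarAlgebra.mem_center (hA : IsCStarAlgebra A) (hqc : IsQuasiCommutative A) {c : A}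
    (hI : hA.scalarHom quatI * c = c * hA.scalarHom quatI)
    (hJ : hA.scalarHom quatJ * c = c * hA.scalarHom quatJ) :
    c ∈ Subalgebra.center ℝ A ∧ star c = c := by
  obtain ⟨τ, hadd, hstar, hcen, hquad⟩ := hqc.exists_trace
  have h := hA.isUnitPair.add_self_eq_trace hadd hcen hquad hI hJ
  have h2 : (2 : ℝ) • c = τ c := by rw [two_smul, h]
  constructor
  · rw [← inv_smul_smul₀ (two_ne_zero (α := ℝ)) c, h2]
    exact Subalgebra.smul_mem _
      (Subalgebra.mem_center_iff.2 (Subring.mem_center_iff.1 (hcen c))) _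
  · have h3 : star (c + c) = c + c := by rw [h]; exact hstar c
    rw [star_add, ← two_smul ℝ, ← two_smul ℝ] at h3
    exact smul_right_injective A (two_ne_zero (α := ℝ)) h3

theorem IsCStarAlgebra.star_eq_of_mem_center (hA : IsCStarAlgebra A)
    (hqc : IsQuasiCommutative A) {c : A} (hc : c ∈ Subalgebra.center ℝ A) : star c = c :=
  (hA.mem_center hqc (Subalgebra.mem_center_iff.1 hc _) (Subalgebra.mem_center_iff.1 hc _)).2

theorem IsCStarAlgebra.unitAvg_mem_center (hA : IsCStarAlgebra A) (hqc : IsQuasiCommutative A)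
    (x : A) : unitAvg (hA.scalarHom quatI) (hA.scalarHom quatJ) x ∈
      Subalgebra.center ℝ A :=
  (hA.mem_center hqc (hA.isUnitPair.comm_unitAvg_left x) (hA.isUnitPair.comm_unitAvg_right x)).1

/-- The centralizer of `i` is a commutative complex `C*`-algebra. It is presented as an abstract
one, `B`, with an isometric `*`-embedding `j` onto the centralizer. -/
theorem IsCStarAlgebra.exists_commCStarAlgebra (hA : IsCStarAlgebra A)
    (hqc : IsQuasiCommutative A) :
    ∃ (B : Type u) (_ : CommCStarAlgebra B) (j : B →+* A), (∀ b, ‖j b‖ = ‖b‖) ∧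
      (∀ b, j (star b) = star (j b)) ∧
      (∀ (c : ℂ) b, j (c • b) = hA.scalarHom (c : ℍ[ℝ]) * j b) ∧
      ∀ x, (∃ b, j b = x) ↔ hA.scalarHom quatI * x = x * hA.scalarHom quatI := by
  set I : A := hA.scalarHom quatI with hIdef
  have hstarI : star I = -I := by
    rw [hIdef, hA.star_scalarHom, star_quatI, map_neg]
  let B := Subring.centralizer ({I} : Set A)
  have hB : ∀ x : A, x ∈ B ↔ I * x = x * I := fun x => by
    simp [B, Subring.mem_centralizer_iff]
  -- `star i = -i` keeps the centralizer `B` of `i` closed under `star`.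
  have hstar : ∀ x : A, x ∈ B → star x ∈ B := fun x hx => by
    have h1 := congrArg star ((hB x).1 hx)
    rw [star_mul, star_mul, hstarI, mul_neg, neg_mul, neg_inj] at h1
    exact (hB _).2 h1.symm
  -- Elements of `B` have the form `z + i w` with `z`, `w` central.
  have hmul : ∀ x y : A, x ∈ B → y ∈ B → x * y = y * x := fun x y hx hy => by
    have hI : ∀ z ∈ Subalgebra.center ℝ A, I * z * y = y * (I * z) := fun z hz => by
      rw [mul_assoc, ← Subalgebra.mem_center_iff.1 hz y, ← mul_assoc, (hB y).1 hy, mul_assoc]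
    rw [hA.isUnitPair.eq_add_of_comm ((hB x).1 hx), sub_mul, mul_sub,
      hI _ (hA.unitAvg_mem_center hqc _),
      Subalgebra.mem_center_iff.1 (hA.unitAvg_mem_center hqc x) y]
  have hc : ∀ c : ℂ, hA.scalarHom (c : ℍ[ℝ]) ∈ B := fun c =>
    (hB _).2 (hA.scalarHom_coeComplex_comm c rfl).symm
  let : NormedCommRing B :=
    { (inferInstance : NormedRing B) with
      mul_comm := fun x y => Subtype.ext (hmul x y x.2 y.2) }
  let : StarRing B :=
    { star := fun x => ⟨star x.1, hstar _ x.2⟩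
      star_involutive := fun x => Subtype.ext (star_star x.1)
      star_mul := fun x y => Subtype.ext (star_mul x.1 y.1)
      star_add := fun x y => Subtype.ext (star_add x.1 y.1) }
  let : Algebra ℂ B := RingHom.toAlgebra
    ((hA.scalarHom.toRingHom.comp Quaternion.ofComplex.toRingHom).codRestrict B hc)
  have hsmul : ∀ (c : ℂ) (b : B), ((c • b : B) : A) = hA.scalarHom (c : ℍ[ℝ]) * b :=
    fun c b => rfl
  let : NormedAlgebra ℂ B :=
    { (inferInstance : Algebra ℂ B) with
      norm_smul_le := fun c b => by
        refine le_of_eq ?_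
        change ‖((c • b : B) : A)‖ = ‖c‖ * ‖(b : A)‖
        rw [hsmul, hA.norm_scalarHom_mul, norm_coeComplex] }
  have : CompleteSpace A := hA.complete
  have : CompleteSpace B := (Set.isClosed_centralizer ({I} : Set A)).completeSpace_coe
  have : CStarRing B := ⟨fun x => by
    have := hA.cstar_identity x.1
    rw [pow_two] at this
    exact this.ge⟩
  have : StarModule ℂ B := ⟨fun c b => Subtype.ext (by
    change star ((c • b : B) : A) = ((star c • star b : B) : A)
    rw [hsmul, hsmul, star_mul, hA.star_scalarHom]
    change star b.1 * _ = _ * star b.1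
    rw [hA.scalarHom_coeComplex_comm _ ((hB _).1 (hstar _ b.2))]
    congr 2
    ext <;> simp)⟩
  exact ⟨B, { }, B.subtype, fun b => rfl, fun b => rfl, hsmul, fun x => by simp [← hB]⟩

/-- **Gelfand representation of the centre.** The centre is the self-adjoint part of the
centralizer of `i`, so it is the algebra of all real continuous functions on a compact space `X`,
and every proper two-sided ideal meets it in functions with a common zero. -/
theorem IsCStarAlgebra.exists_center_equiv (hA : IsCStarAlgebra A) (hqc : IsQuasiCommutative A) :
    ∃ (X : Type u) (_ : TopologicalSpace X) (_ : CompactSpace X)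
      (e : Subalgebra.center ℝ A ≃ₐ[ℝ] C(X, ℝ)), (∀ z, ‖e z‖ = ‖z‖) ∧
      ∀ M : TwoSidedIdeal A, M ≠ ⊤ → ∃ t : X, ∀ z : Subalgebra.center ℝ A, z.1 ∈ M → e z t = 0 := by
  obtain ⟨B, _, j, hnorm, hstar, hsmul, hrange⟩ := hA.exists_commCStarAlgebra hqc
  have hinj : Function.Injective j := (injective_iff_map_eq_zero j).2 fun b hb => by
    rw [← norm_eq_zero, ← hnorm, hb, norm_zero]
  have hex : ∀ z : Subalgebra.center ℝ A, ∃ b, j b = z := fun z =>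
    (hrange z).2 (Subalgebra.mem_center_iff.1 z.2 _)
  choose k hk using hex
  have hkstar : ∀ z, star (k z) = k z := fun z => hinj (by
    rw [hstar, hk, hA.star_eq_of_mem_center hqc z.2])
  -- Characters are `*`-homomorphisms, hence real on the centre.
  have hreal : ∀ z (t : WeakDual.characterSpace ℂ B), ((t (k z)).re : ℂ) = t (k z) := fun z t => by
    rw [← Complex.conj_eq_iff_re, starRingEnd_apply, ← map_star, hkstar]
  let f : Subalgebra.center ℝ A →ₐ[ℝ] C(WeakDual.characterSpace ℂ B, ℝ) :=
    { toFun := fun z => ⟨fun t => (t (k z)).re,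
        Complex.continuous_re.comp (WeakDual.gelfandTransform ℂ B (k z)).continuous⟩
      map_one' := by
        ext t
        have : k 1 = 1 := hinj (by rw [hk, map_one]; rfl)
        simp [this]
      map_mul' := fun z w => by
        ext t
        have : k (z * w) = k z * k w := hinj (by rw [hk, map_mul, hk, hk]; rfl)
        simp only [this, map_mul, ContinuousMap.coe_mk, ContinuousMap.coe_mul, Pi.mul_apply]
        rw [← hreal z, ← hreal w]
        simp
      map_zero' := by
        ext t
        have : k 0 = 0 := hinj (by rw [hk, map_zero]; rfl)
        simp [this]
      map_add' := fun z w => by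
        ext t
        have : k (z + w) = k z + k w := hinj (by rw [hk, map_add, hk, hk]; rfl)
        simp [this]
      commutes' := fun r => by
        ext t
        have : k (algebraMap ℝ _ r) = (r : ℂ) • (1 : B) := hinj (by
          rw [hk, hsmul, map_one, mul_one, Quaternion.coeComplex_coe]
          exact (hA.scalarHom.commutes r).symm)
        change (t (k (algebraMap ℝ _ r))).re = r
        rw [this, map_smul, map_one]
        simp }
  have hf : ∀ z t, ((f z t : ℝ) : ℂ) = WeakDual.gelfandTransform ℂ B (k z) t := hreal
  have hfnorm : ∀ z, ‖f z‖ = ‖z‖ := fun z => by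
    have h1 : ‖z‖ = ‖WeakDual.gelfandTransform ℂ B (k z)‖ := by
      rw [(AddMonoidHomClass.isometry_iff_norm _).1 (gelfandTransform_isometry B), ← hnorm, hk]
      rfl
    rw [h1]
    refine le_antisymm ((ContinuousMap.norm_le _ (norm_nonneg _)).2 fun t => ?_)
      ((ContinuousMap.norm_le _ (norm_nonneg _)).2 fun t => ?_)
    · rw [← Complex.norm_real, hf]
      exact ContinuousMap.norm_coe_le_norm _ t
    · rw [← hf, Complex.norm_real]
      exact ContinuousMap.norm_coe_le_norm _ t
  have hfbij : Function.Bijective f := by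
    refine ⟨(injective_iff_map_eq_zero f).2 fun z hz => ?_, fun g => ?_⟩
    · rw [← norm_eq_zero, ← hfnorm, hz, norm_zero]
    · obtain ⟨b, hb⟩ := (gelfandTransform_bijective B).2
        ⟨fun t => (g t : ℂ), Complex.continuous_ofReal.comp g.continuous⟩
      have hbt : ∀ t : WeakDual.characterSpace ℂ B, t b = g t := fun t => DFunLike.congr_fun hb t
      have hbs : star b = b := (gelfandTransform_bijective B).1 (by
        ext t
        change t (star b) = t b
        rw [map_star, hbt]
        exact Complex.conj_ofReal _)
      -- `j b` commutes with `i` and is self-adjoint, so its `i` component vanishes.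
      have hcomm := (hrange (j b)).1 ⟨b, rfl⟩
      have hdec := hA.isUnitPair.eq_add_of_comm hcomm
      set z := unitAvg (hA.scalarHom quatI) (hA.scalarHom quatJ) (j b)
      set w := unitAvg (hA.scalarHom quatI) (hA.scalarHom quatJ)
        (hA.scalarHom quatI * j b)
      have hz : z ∈ Subalgebra.center ℝ A := hA.unitAvg_mem_center hqc _
      have hw : w ∈ Subalgebra.center ℝ A := hA.unitAvg_mem_center hqc _
      have hsI : star (hA.scalarHom quatI * w) = -(hA.scalarHom quatI * w) := by
        rw [star_mul, hA.star_eq_of_mem_center hqc hw, hA.star_scalarHom, star_quatI, map_neg,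
          mul_neg, Subalgebra.mem_center_iff.1 hw]
      have hs : star (j b) = j b := by rw [← hstar, hbs]
      rw [hdec, star_sub, hsI, hA.star_eq_of_mem_center hqc hz, sub_right_inj] at hs
      have hIw : hA.scalarHom quatI * w = 0 := by
        rwa [neg_eq_iff_add_eq_zero, ← two_smul ℝ, smul_eq_zero_iff_right two_ne_zero] at hs
      rw [hIw, sub_zero] at hdec
      refine ⟨⟨z, hz⟩, ?_⟩
      ext t
      have : k ⟨z, hz⟩ = b := hinj (by rw [hk, hdec])
      change (t (k ⟨z, hz⟩)).re = g t
      rw [this, hbt, Complex.ofReal_re]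
  refine ⟨_, _, inferInstance, AlgEquiv.ofBijective f hfbij, hfnorm, fun M hM => ?_⟩
  let N : Ideal B :=
    { carrier := {b | j b ∈ M}
      add_mem' := fun {a b} ha hb => by
        change j (a + b) ∈ M
        rw [map_add]; exact M.add_mem ha hb
      zero_mem' := by
        change j 0 ∈ M
        rw [map_zero]; exact M.zero_mem
      smul_mem' := fun c b hb => by
        change j (c * b) ∈ M
        rw [map_mul]; exact M.mul_mem_left _ _ hb }
  have hN : N ≠ ⊤ := fun h => hM ((TwoSidedIdeal.one_mem_iff M).1 (by
    have : (1 : B) ∈ N := h ▸ Submodule.mem_top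
    rw [← map_one j]
    exact this))
  -- A maximal ideal of the centralizer above `M ∩ B` is the kernel of the required character.
  obtain ⟨P, _, hNP⟩ := Ideal.exists_le_maximal N hN
  refine ⟨P.toCharacterSpace, fun z hz => ?_⟩
  have hzN : k z ∈ N := by
    change j (k z) ∈ M
    rwa [hk]
  have h0 := Ideal.toCharacterSpace_apply_eq_zero_of_mem P (hNP hzN)
  change (P.toCharacterSpace (k z)).re = 0
  rw [h0, Complex.zero_re]

end Center

/-! ### The spectrum as an image of the Gelfand space of the centre -/

section Spectrum

variable {A : Type u} [NormedRing A] [NormedAlgebra ℝ A] [Module ℍ[ℝ] A] [Module (ℍ[ℝ])ᵐᵒᵖ A]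

theorem IsBanachAlgebra.eq_zero_of_scalarHom_mem (hA : IsBanachAlgebra A) {M : TwoSidedIdeal A}
    (hM : M ≠ ⊤) {q : ℍ[ℝ]} (hq : hA.scalarHom q ∈ M) : q = 0 := by
  by_contra hne
  refine hM ((TwoSidedIdeal.one_mem_iff M).1 ?_)
  rw [← map_one hA.scalarHom, ← inv_mul_cancel₀ hne, map_mul]
  exact M.mul_mem_left _ _ hq

theorem IsBanachAlgebra.eq_of_sub_mem (hA : IsBanachAlgebra A) {M : TwoSidedIdeal A}
    (hM : M ≠ ⊤) {x : A} {p q : ℍ[ℝ]} (hp : x - hA.scalarHom p ∈ M)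
    (hq : x - hA.scalarHom q ∈ M) : p = q := by
  have h := M.sub_mem hq hp
  rw [sub_sub_sub_cancel_left, ← map_sub] at h
  exact sub_eq_zero.1 (hA.eq_zero_of_scalarHom_mem hM h)

/-- A proper two-sided ideal with quotient `ℍ` is maximal: an ideal strictly above it contains a
nonzero quaternion scalar. -/
theorem IsBanachAlgebra.isCoatom_of_forall_exists (hA : IsBanachAlgebra A) {M : TwoSidedIdeal A}
    (hM : M ≠ ⊤) (h : ∀ x, ∃ q, x - hA.scalarHom q ∈ M) : IsCoatom M := by
  refine ⟨hM, fun N hMN => ?_⟩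
  obtain ⟨x, hxN, hxM⟩ := SetLike.exists_of_lt hMN
  obtain ⟨q, hq⟩ := h x
  by_contra hN
  have hqN : hA.scalarHom q ∈ N := by
    have h1 := N.sub_mem hxN (hMN.le hq)
    rwa [sub_sub_cancel] at h1
  rw [hA.eq_zero_of_scalarHom_mem hN hqN, map_zero, sub_zero] at hq
  exact hxM hq

end Spectrum

theorem continuous_value {A : Type u} [Ring A] [Module ℍ[ℝ] A] (x : A) :
    Continuous fun M : Spectrum A => value x M :=
  (continuous_apply x).comp (continuous_induced_dom (f := fun (M : Spectrum A) x => value x M))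

section CStar

variable {A : Type u} [NormedRing A] [NormedAlgebra ℝ A] [StarRing A]
  [Module ℍ[ℝ] A] [Module (ℍ[ℝ])ᵐᵒᵖ A]

/-- The real component of an element, as an element of the centre. -/
noncomputable def IsCStarAlgebra.realPart (hA : IsCStarAlgebra A) (hqc : IsQuasiCommutative A)
    (x : A) : Subalgebra.center ℝ A :=
  ⟨unitAvg (hA.scalarHom quatI) (hA.scalarHom quatJ) x, hA.unitAvg_mem_center hqc x⟩

theorem IsCStarAlgebra.realPart_add (hA : IsCStarAlgebra A) (hqc : IsQuasiCommutative A)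
    (x y : A) : hA.realPart hqc (x + y) = hA.realPart hqc x + hA.realPart hqc y :=
  Subtype.ext (unitAvg_add x y)

theorem IsCStarAlgebra.realPart_neg (hA : IsCStarAlgebra A) (hqc : IsQuasiCommutative A)
    (x : A) : hA.realPart hqc (-x) = -hA.realPart hqc x :=
  Subtype.ext (unitAvg_neg x)

theorem IsCStarAlgebra.eq_sum_realPart (hA : IsCStarAlgebra A) (hqc : IsQuasiCommutative A)
    (x : A) : x = hA.realPart hqc x
      - hA.scalarHom quatI * hA.realPart hqc (hA.scalarHom quatI * x)
      - hA.scalarHom quatJ * hA.realPart hqc (hA.scalarHom quatJ * x)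
      - hA.scalarHom quatI * hA.scalarHom quatJ *
        hA.realPart hqc (hA.scalarHom quatI * hA.scalarHom quatJ * x) :=
  hA.isUnitPair.eq_sum_unitAvg x

/-- The maximal two-sided ideals are parametrized by the points of the Gelfand space `X` of the
centre: `π t` consists of the `x` such that the real components of all `u x v` vanish at `t`. -/
theorem IsCStarAlgebra.exists_spectrum_param (hA : IsCStarAlgebra A)
    (hqc : IsQuasiCommutative A) :
    ∃ (X : Type u) (_ : TopologicalSpace X) (_ : CompactSpace X)
      (e : Subalgebra.center ℝ A ≃ₐ[ℝ] C(X, ℝ)) (π : X → Spectrum A), (∀ z, ‖e z‖ = ‖z‖) ∧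
      Function.Surjective π ∧ (∀ t x, ∃ q, x - hA.scalarHom q ∈ (π t).1) ∧
      ∀ t (z : Subalgebra.center ℝ A), z.1 - hA.scalarHom (e z t : ℍ[ℝ]) ∈ (π t).1 := by
  obtain ⟨X, _, _, e, he, hzero⟩ := hA.exists_center_equiv hqc
  let N : X → TwoSidedIdeal A := fun t =>
    TwoSidedIdeal.mk' {x | ∀ u v, e (hA.realPart hqc (u * x * v)) t = 0}
      (fun u v => by
        have h0 : hA.realPart hqc 0 = 0 := Subtype.ext unitAvg_zero
        rw [mul_zero, zero_mul, h0, map_zero]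
        rfl)
      (fun {x y} hx hy u v => by
        rw [mul_add, add_mul, hA.realPart_add, map_add, ContinuousMap.add_apply, hx, hy, add_zero])
      (fun {x} hx u v => by
        rw [mul_neg, neg_mul, hA.realPart_neg, map_neg, ContinuousMap.neg_apply, hx, neg_zero])
      (fun {x y} hy u v => by
        rw [← mul_assoc]
        exact hy _ v)
      (fun {x y} hx u v => by
        rw [← mul_assoc, mul_assoc]
        exact hx u _)
  have hN : ∀ t x, x ∈ N t ↔ ∀ u v, e (hA.realPart hqc (u * x * v)) t = 0 := fun t x =>
    TwoSidedIdeal.mem_mk' _ _ _ _ _ _ _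
  have hNtop : ∀ t, N t ≠ ⊤ := fun t h => by
    have h1 := (hN t 1).1 ((TwoSidedIdeal.one_mem_iff _).2 h) 1 1
    have h2 : hA.realPart hqc (1 * 1 * 1) = 1 := Subtype.ext (by
      rw [mul_one, mul_one]
      exact hA.isUnitPair.unitAvg_one)
    rw [h2, map_one, ContinuousMap.one_apply] at h1
    exact one_ne_zero h1
  have hNz : ∀ t (z : Subalgebra.center ℝ A), z.1 - hA.scalarHom (e z t : ℍ[ℝ]) ∈ N t := by
    intro t z
    have h1 : ∀ w : Subalgebra.center ℝ A, e w t = 0 → w.1 ∈ N t := fun w hw =>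
      (hN t w.1).2 fun u v => by
        have h2 : hA.realPart hqc (u * w.1 * v) = w * hA.realPart hqc (u * v) := Subtype.ext (by
          rw [Subalgebra.mem_center_iff.1 w.2, mul_assoc]
          exact unitAvg_center_mul
            (Subring.mem_center_iff.2 (Subalgebra.mem_center_iff.1 w.2)) _)
        rw [h2, map_mul, ContinuousMap.mul_apply, hw, zero_mul]
    have h3 : z.1 - hA.scalarHom (e z t : ℍ[ℝ]) =
        (z - algebraMap ℝ (Subalgebra.center ℝ A) (e z t)).1 :=
      congrArg (z.1 - ·) (hA.scalarHom.commutes (e z t))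
    rw [h3]
    refine h1 _ ?_
    rw [map_sub, AlgEquiv.commutes, ContinuousMap.sub_apply, sub_eq_zero]
    change e z t = (algebraMap ℝ ℝ) (e z t)
    rfl
  have hval : ∀ t x, ∃ q, x - hA.scalarHom q ∈ N t := fun t x => by
    have hmul : ∀ {x y : A} {p q : ℍ[ℝ]}, x - hA.scalarHom p ∈ N t → y - hA.scalarHom q ∈ N t →
        x * y - hA.scalarHom (p * q) ∈ N t := fun {x y p q} hx hy => by
      have h1 := (N t).add_mem ((N t).mul_mem_right _ y hx)
        ((N t).mul_mem_left (hA.scalarHom p) _ hy)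
      rwa [sub_mul, mul_sub, sub_add_sub_cancel, ← map_mul] at h1
    have hsub : ∀ {x y : A} {p q : ℍ[ℝ]}, x - hA.scalarHom p ∈ N t → y - hA.scalarHom q ∈ N t →
        x - y - hA.scalarHom (p - q) ∈ N t := fun {x y p q} hx hy => by
      have h1 := (N t).sub_mem hx hy
      rwa [sub_sub_sub_comm, ← map_sub] at h1
    have hscal : ∀ q, hA.scalarHom q - hA.scalarHom q ∈ N t := fun q => by
      rw [sub_self]
      exact (N t).zero_mem
    rw [hA.eq_sum_realPart hqc x]
    exact ⟨_, hsub (hsub (hsub (hNz t _) (hmul (hscal _) (hNz t _)))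
      (hmul (hscal _) (hNz t _))) (hmul (hmul (hscal _) (hscal _)) (hNz t _))⟩
  refine ⟨X, _, ‹_›, e, fun t => ⟨N t, hA.isCoatom_of_forall_exists (hNtop t) (hval t)⟩, he,
    fun M => ?_, hval, hNz⟩
  obtain ⟨t, ht⟩ := hzero M.1 M.2.1
  refine ⟨t, Subtype.ext ?_⟩
  have hle : M.1 ≤ N t := fun x hx => (hN t x).2 fun u v =>
    ht _ (unitAvg_mem (M.1.mul_mem_right _ v (M.1.mul_mem_left u _ hx)))
  exact (hle.eq_or_lt.resolve_right fun hlt => hNtop t (M.2.2 _ hlt)).symm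

/-! ### The value of an element at a maximal ideal -/

theorem IsCStarAlgebra.existsUnique_sub_mem (hA : IsCStarAlgebra A) (hqc : IsQuasiCommutative A)
    (x : A) (M : Spectrum A) : ∃! q : ℍ[ℝ], x - hA.scalarHom q ∈ M.1 := by
  obtain ⟨X, _, _, e, π, -, hπ, hval, -⟩ := hA.exists_spectrum_param hqc
  obtain ⟨t, rfl⟩ := hπ M
  obtain ⟨q, hq⟩ := hval t x
  exact ⟨q, hq, fun p hp => hA.eq_of_sub_mem (π t).2.1 hp hq⟩

theorem IsCStarAlgebra.sub_value_mem (hA : IsCStarAlgebra A) (hqc : IsQuasiCommutative A)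
    (x : A) (M : Spectrum A) : x - hA.scalarHom (value x M) ∈ M.1 :=
  Classical.epsilon_spec (hA.existsUnique_sub_mem hqc x M).exists

theorem IsCStarAlgebra.value_eq (hA : IsCStarAlgebra A) (hqc : IsQuasiCommutative A)
    {x : A} {M : Spectrum A} {q : ℍ[ℝ]} (h : x - hA.scalarHom q ∈ M.1) : value x M = q :=
  hA.eq_of_sub_mem M.2.1 (hA.sub_value_mem hqc x M) h

theorem IsCStarAlgebra.value_eq_zero_iff (hA : IsCStarAlgebra A) (hqc : IsQuasiCommutative A)
    {x : A} {M : Spectrum A} : value x M = 0 ↔ x ∈ M.1 := by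
  constructor
  · intro h
    have h1 := hA.sub_value_mem hqc x M
    rwa [h, map_zero, sub_zero] at h1
  · intro h
    exact hA.value_eq hqc (by rwa [map_zero, sub_zero])

theorem IsCStarAlgebra.value_scalarHom (hA : IsCStarAlgebra A) (hqc : IsQuasiCommutative A)
    (q : ℍ[ℝ]) (M : Spectrum A) : value (hA.scalarHom q) M = q :=
  hA.value_eq hqc (by
    rw [sub_self]
    exact M.1.zero_mem)

theorem IsCStarAlgebra.value_add (hA : IsCStarAlgebra A) (hqc : IsQuasiCommutative A)
    (x y : A) (M : Spectrum A) : value (x + y) M = value x M + value y M :=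
  hA.value_eq hqc (by
    rw [map_add, add_sub_add_comm]
    exact M.1.add_mem (hA.sub_value_mem hqc x M) (hA.sub_value_mem hqc y M))

theorem IsCStarAlgebra.value_sub (hA : IsCStarAlgebra A) (hqc : IsQuasiCommutative A)
    (x y : A) (M : Spectrum A) : value (x - y) M = value x M - value y M :=
  hA.value_eq hqc (by
    rw [map_sub, sub_sub_sub_comm]
    exact M.1.sub_mem (hA.sub_value_mem hqc x M) (hA.sub_value_mem hqc y M))

theorem IsCStarAlgebra.value_mul (hA : IsCStarAlgebra A) (hqc : IsQuasiCommutative A)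
    (x y : A) (M : Spectrum A) : value (x * y) M = value x M * value y M :=
  hA.value_eq hqc (by
    have h := M.1.add_mem (M.1.mul_mem_right _ y (hA.sub_value_mem hqc x M))
      (M.1.mul_mem_left (hA.scalarHom (value x M)) _ (hA.sub_value_mem hqc y M))
    rwa [sub_mul, mul_sub, sub_add_sub_cancel, ← map_mul] at h)

/-- Two-sided ideals are `*`-closed, as the adjoint only changes signs of components. -/
theorem IsCStarAlgebra.star_mem (hA : IsCStarAlgebra A) (hqc : IsQuasiCommutative A)
    {M : TwoSidedIdeal A} {x : A} (hx : x ∈ M) : star x ∈ M := by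
  have hmem : ∀ y ∈ M, ∀ q, star (hA.scalarHom q * (hA.realPart hqc y : A)) ∈ M := fun y hy q => by
    rw [star_mul, hA.star_eq_of_mem_center hqc (hA.realPart hqc y).2]
    exact M.mul_mem_right _ _ (unitAvg_mem hy)
  have h1 : star (hA.realPart hqc x : A) ∈ M := by
    rw [hA.star_eq_of_mem_center hqc (hA.realPart hqc x).2]
    exact unitAvg_mem hx
  rw [hA.eq_sum_realPart hqc x, star_sub, star_sub, star_sub, ← map_mul]
  exact M.sub_mem (M.sub_mem (M.sub_mem h1 (hmem _ (M.mul_mem_left _ _ hx) _))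
    (hmem _ (M.mul_mem_left _ _ hx) _)) (hmem _ (M.mul_mem_left _ _ hx) _)

theorem IsCStarAlgebra.value_star (hA : IsCStarAlgebra A) (hqc : IsQuasiCommutative A)
    (x : A) (M : Spectrum A) : value (star x) M = star (value x M) :=
  hA.value_eq hqc (by
    rw [← hA.star_scalarHom, ← star_sub]
    exact hA.star_mem hqc (hA.sub_value_mem hqc x M))

theorem IsCStarAlgebra.t2Space (hA : IsCStarAlgebra A) (hqc : IsQuasiCommutative A) :
    T2Space (Spectrum A) := by
  refine T2Space.of_injective_continuous (f := fun (M : Spectrum A) (x : A) => value x M) ?_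
    continuous_induced_dom
  intro M M' h
  refine Subtype.ext (SetLike.ext fun x => ?_)
  rw [← hA.value_eq_zero_iff hqc, ← hA.value_eq_zero_iff hqc,
    show value x M = value x M' from congrFun h x]

/-- The representation `x ↦ x(·)` as a homomorphism into the continuous functions. -/
noncomputable def IsCStarAlgebra.valueHom (hA : IsCStarAlgebra A) (hqc : IsQuasiCommutative A) :
    A →⋆ₐ[ℝ] C(Spectrum A, ℍ[ℝ]) where
  toFun x := ⟨fun M => value x M, continuous_value x⟩
  map_one' := ContinuousMap.ext fun M => by
    rw [← map_one hA.scalarHom]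
    exact hA.value_scalarHom hqc _ _
  map_mul' x y := ContinuousMap.ext fun M => hA.value_mul hqc x y M
  map_zero' := ContinuousMap.ext fun M => by
    rw [← map_zero hA.scalarHom]
    exact hA.value_scalarHom hqc _ _
  map_add' x y := ContinuousMap.ext fun M => hA.value_add hqc x y M
  commutes' r := ContinuousMap.ext fun M => by
    rw [← hA.scalarHom.commutes]
    exact hA.value_scalarHom hqc _ _
  map_star' x := ContinuousMap.ext fun M => hA.value_star hqc x M

theorem IsCStarAlgebra.valueHom_apply (hA : IsCStarAlgebra A) (hqc : IsQuasiCommutative A)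
    (x : A) (M : Spectrum A) : hA.valueHom hqc x M = value x M := rfl

theorem quaternion_eq_sum (q : ℍ[ℝ]) : q = (q.re : ℍ[ℝ]) + quatI * (q.imI : ℍ[ℝ])
    + quatJ * (q.imJ : ℍ[ℝ]) + quatI * quatJ * (q.imK : ℍ[ℝ]) := by
  ext <;> simp

/-- The spectrum is compact and the Gelfand representation is bijective and isometric. Isometry is
proved on the centre first and carried over to `A` by the `C*`-identity, as `x* x` is central. -/
theorem IsCStarAlgebra.valueHom_bijective_isometry (hA : IsCStarAlgebra A)
    (hqc : IsQuasiCommutative A) :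
    ∃ _ : CompactSpace (Spectrum A), Function.Bijective (hA.valueHom hqc) ∧
      Isometry (hA.valueHom hqc) := by
  obtain ⟨X, _, _, e, π, he, hπ, -, hz⟩ := hA.exists_spectrum_param hqc
  have hze : ∀ t (z : Subalgebra.center ℝ A), value z.1 (π t) = (e z t : ℍ[ℝ]) := fun t z =>
    hA.value_eq hqc (hz t z)
  have hdec : ∀ t x, value x (π t) = (e (hA.realPart hqc x) t : ℍ[ℝ])
      - quatI * (e (hA.realPart hqc (hA.scalarHom quatI * x)) t : ℍ[ℝ])
      - quatJ * (e (hA.realPart hqc (hA.scalarHom quatJ * x)) t : ℍ[ℝ])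
      - quatI * quatJ *
        (e (hA.realPart hqc (hA.scalarHom quatI * hA.scalarHom quatJ * x)) t : ℍ[ℝ]) := by
    intro t x
    conv_lhs => rw [hA.eq_sum_realPart hqc x]
    simp only [hA.value_sub hqc, hA.value_mul hqc, hA.value_scalarHom hqc, hze]
  have hcont : Continuous π := by
    refine continuous_induced_rng.2 (continuous_pi fun x => ?_)
    have : ∀ z : Subalgebra.center ℝ A, Continuous fun t => (e z t : ℍ[ℝ]) := fun z =>
      Quaternion.continuous_coe.comp (e z).continuous
    simp only [Function.comp_apply, hdec]
    exact (((this _).sub (continuous_const.mul (this _))).sub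
      (continuous_const.mul (this _))).sub (continuous_const.mul (this _))
  have hcompact : CompactSpace (Spectrum A) := hπ.compactSpace hcont
  have hinj : Function.Injective (hA.valueHom hqc) := by
    refine (injective_iff_map_eq_zero _).2 fun x hx => ?_
    have h0 : ∀ t, value x (π t) = 0 := fun t => DFunLike.congr_fun hx (π t)
    -- A vanishing quaternion has four vanishing components, at every point of `X`.
    have hre : hA.realPart hqc x = 0 := e.injective (by
      ext t
      simpa [h0] using (congrArg (fun q : ℍ[ℝ] => q.re) (hdec t x)).symm)
    have hi : hA.realPart hqc (hA.scalarHom quatI * x) = 0 := e.injective (by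
      ext t
      simpa [h0] using (congrArg (fun q : ℍ[ℝ] => q.imI) (hdec t x)).symm)
    have hj : hA.realPart hqc (hA.scalarHom quatJ * x) = 0 := e.injective (by
      ext t
      simpa [h0] using (congrArg (fun q : ℍ[ℝ] => q.imJ) (hdec t x)).symm)
    have hk : hA.realPart hqc (hA.scalarHom quatI * hA.scalarHom quatJ * x) = 0 := e.injective (by
      ext t
      simpa [h0] using (congrArg (fun q : ℍ[ℝ] => q.imK) (hdec t x)).symm)
    rw [hA.eq_sum_realPart hqc x, hre, hi, hj, hk]
    simp
  have hsurj : Function.Surjective (hA.valueHom hqc) := by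
    intro f
    have hf := f.continuous.comp hcont
    let z : ∀ g : ℍ[ℝ] → ℝ, Continuous g → Subalgebra.center ℝ A := fun g hg =>
      e.symm ⟨fun t => g (f (π t)), hg.comp hf⟩
    have hzt : ∀ g hg t, value (z g hg).1 (π t) = (g (f (π t)) : ℍ[ℝ]) := fun g hg t => by
      rw [hze, e.apply_symm_apply]
      rfl
    refine ⟨(z _ Quaternion.continuous_re).1
      + hA.scalarHom quatI * (z _ Quaternion.continuous_imI).1
      + hA.scalarHom quatJ * (z _ Quaternion.continuous_imJ).1
      + hA.scalarHom quatI * hA.scalarHom quatJ * (z _ Quaternion.continuous_imK).1, ?_⟩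
    refine ContinuousMap.ext fun M => ?_
    obtain ⟨t, rfl⟩ := hπ M
    rw [hA.valueHom_apply]
    simp only [hA.value_add hqc, hA.value_mul hqc, hA.value_scalarHom hqc, hzt]
    exact (quaternion_eq_sum _).symm
  refine ⟨hcompact, ⟨hinj, hsurj⟩, ?_⟩
  have hnormz : ∀ z : Subalgebra.center ℝ A, ‖hA.valueHom hqc z.1‖ = ‖z.1‖ := by
    intro z
    have h1 : ∀ t, ‖hA.valueHom hqc z.1 (π t)‖ = ‖e z t‖ := fun t => by
      rw [hA.valueHom_apply, hze, Quaternion.norm_coe]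
    rw [show ‖z.1‖ = ‖e z‖ from (he z).symm]
    refine le_antisymm ((ContinuousMap.norm_le _ (norm_nonneg _)).2 fun M => ?_)
      ((ContinuousMap.norm_le _ (norm_nonneg _)).2 fun t => ?_)
    · obtain ⟨t, rfl⟩ := hπ M
      rw [h1]
      exact ContinuousMap.norm_coe_le_norm _ t
    · rw [← h1]
      exact ContinuousMap.norm_coe_le_norm _ _
  refine (AddMonoidHomClass.isometry_iff_norm _).2 fun x => ?_
  -- `x* x` has real values, so it equals its real component and lies in the centre.
  have hn : (hA.realPart hqc (star x * x) : A) = star x * x := by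
    refine hinj (ContinuousMap.ext fun M => ?_)
    obtain ⟨t, rfl⟩ := hπ M
    rw [hA.valueHom_apply, hA.valueHom_apply, hze]
    have h2 : value (star x * x) (π t) = ((Quaternion.normSq (value x (π t)) : ℝ) : ℍ[ℝ]) := by
      rw [hA.value_mul hqc, hA.value_star hqc, Quaternion.star_mul_self]
    have h3 := congrArg (fun q : ℍ[ℝ] => q.re) (hdec t (star x * x))
    rw [h2] at h3 ⊢
    simp at h3
    rw [h3]
  have h4 := hnormz (hA.realPart hqc (star x * x))
  rw [hn, hA.cstar_identity, map_mul, map_star] at h4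
  have h5 : ‖hA.valueHom hqc x‖ ^ 2 = ‖x‖ ^ 2 := by
    rw [← h4, pow_two, CStarRing.norm_star_mul_self]
  exact (sq_eq_sq₀ (norm_nonneg _) (norm_nonneg _)).1 h5

end CStar

end QuaternionCStar

theorem theorem2p22 {A : Type u} [NormedRing A] [NormedAlgebra ℝ A] [StarRing A]
    [Module ℍ[ℝ] A] [Module (ℍ[ℝ])ᵐᵒᵖ A]
    (hA : QuaternionCStar.IsCStarAlgebra A) (hqc : QuaternionCStar.IsQuasiCommutative A) :
    (∀ (x : A) (M : QuaternionCStar.Spectrum A), ∃! q : ℍ[ℝ], x - q • (1 : A) ∈ M.1) ∧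
    T2Space (QuaternionCStar.Spectrum A) ∧
    ∃ _ : CompactSpace (QuaternionCStar.Spectrum A),
    ∃ Φ : A ≃⋆ₐ[ℝ] C(QuaternionCStar.Spectrum A, ℍ[ℝ]),
      Isometry Φ ∧
      (∀ (q : ℍ[ℝ]) (x : A), Φ (q • x) = q • Φ x) ∧
      (∀ (q : ℍ[ℝ]) (x : A), Φ (op q • x) = op q • Φ x) ∧
      ∀ (x : A) (M : QuaternionCStar.Spectrum A), Φ x M = QuaternionCStar.value x M := by
  obtain ⟨hcompact, hbij, hiso⟩ := hA.valueHom_bijective_isometry hqc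
  refine ⟨hA.existsUnique_sub_mem hqc, hA.t2Space hqc, hcompact,
    StarAlgEquiv.ofBijective (hA.valueHom hqc) hbij, hiso, fun q x => ?_, fun q x => ?_,
    fun x M => rfl⟩
  · refine ContinuousMap.ext fun M => ?_
    change QuaternionCStar.value (q • x) M = q * QuaternionCStar.value x M
    rw [← hA.smul_one_mul, hA.value_mul hqc, ← hA.scalarHom_apply, hA.value_scalarHom hqc]
  · refine ContinuousMap.ext fun M => ?_
    change QuaternionCStar.value (op q • x) M = QuaternionCStar.value x M * q
    rw [← hA.mul_smul_one, hA.value_mul hqc, ← hA.scalarHom_apply, hA.value_scalarHom hqc]
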